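/- Conventions. Let $\log=\log_2$. For a string $t$ let $H_0(t)=\sum_a \frac{\mathrm{occ}(a,t)}{|t|}\log\frac{|t|}{\mathrm{occ}(a,t)}$, the sum being over the characters $a$ that occur in $t$, where $\mathrm{occ}(a,t)$ is the number of occurrences of $a$ in $t$. For $k\ge 0$ and a string $s$ of length $n$ let $H_k(s)=\frac1n\sum_{|w|=k}|w_s|\,H_0(w_s)$, where $w_s$ is the string of the characters that immediately follow the occurrences of the $k$-tuple $w$ in $s$. A one-pass decoder is an algorithm that is given the alphabet size $\sigma$ and whose memory contents are a bit string. In each step, as computed from $\sigma$ and its current memory contents, it either halts, or changes its memory contents and appends at most one character to its output, or reads the next bit of the encoding (or learns that there are no more bits) and changes its memory contents accordingly. It recovers $s$ from an encoding $e$ using at most $B$ bits of memory if, when run on $e$, it halts with output exactly $s$ and its memory contents never exceed $B$ bits. Theorem. Let $\lambda\ge 1$, $\varepsilon>0$ be real constants and $k\ge 0$ an integer constant. There are strings $s_{\sigma,n}$ ($\sigma\ge1$, $n\ge0$), with $s_{\sigma,n}$ of length $n$ over an alphabet of size $\sigma$, such that the following holds for every one-pass decoder $A$, every constant $C$, every function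 $g=g(\sigma)$ independent of $n$ and every function $f(\sigma,n)=o(n\log\sigma)$, in the sense that for every $\delta>0$ and all sufficiently large $\sigma$ we have $f(\sigma,n)\le\delta\, n\log\sigma$ for all sufficiently large $n$ (depending on $\delta$ and $\sigma$). For all sufficiently large $\sigma$, and all sufficiently large $n$ (depending on $\sigma$), there is no encoding $e\in\{0,1\}^*$ of at most $\lambda H_k(s_{\sigma,n})\,n+f(\sigma,n)+g(\sigma)$ bits from which $A$ recovers $s_{\sigma,n}$ using at most $C\sigma^{k+1/\lambda-\varepsilon}$ bits of memory. -/

import Mathlib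

open Filter

noncomputable section

/-- The empirical entropy of order zero of a string `t`:
`∑ₐ (occ(a,t)/|t|) log₂ (|t|/occ(a,t))`, the sum being over the characters that occur in `t`. -/
def zerothEntropy {α : Type} [DecidableEq α] (t : List α) : ℝ :=
  ∑ a ∈ t.toFinset,
    ((t.count a : ℝ) / (t.length : ℝ)) * Real.logb 2 ((t.length : ℝ) / (t.count a : ℝ))

/-- The string `w_s` of the characters of `s` that immediately follow the (possibly overlapping)
occurrences of the word `w` in `s`, from left to right.  An occurrence of `w` is a suffix of `s`
that starts with `w`; an occurrence at the very end of `s` has no following character. -/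
def followers {α : Type} [DecidableEq α] (w s : List α) : List α :=
  s.tails.filterMap (fun t => if t.take w.length = w then t[w.length]? else none)

/-- The empirical entropy of order `k` of a string `s` over a finite alphabet:
`H_k(s) = (1/|s|) ∑_{|w| = k} |w_s| H_0(w_s)`. -/
def empiricalEntropy {α : Type} [Fintype α] [DecidableEq α] (k : ℕ) (s : List α) : ℝ :=
  (1 / (s.length : ℝ)) * ∑ w : Fin k → α,
    ((followers (List.ofFn w) s).length : ℝ) * zerothEntropy (followers (List.ofFn w) s)

theorem followers_nil {α : Type} [DecidableEq α] (s : List α) : followers [] s = s := by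
  induction s with
  | nil => simp [followers]
  | cons a s ih =>
    simp only [followers, List.length_nil, List.take_zero, if_true, List.tails_cons] at ih ⊢
    rw [List.filterMap_cons_some (b := a) (by simp), ih]

/-- For `k = 0` the general formula gives the entropy of order zero. -/
theorem empiricalEntropy_zero {α : Type} [Fintype α] [DecidableEq α] (s : List α) :
    empiricalEntropy 0 s = zerothEntropy s := by
  rcases s with _ | ⟨a, s⟩
  · simp [empiricalEntropy, zerothEntropy, followers_nil]
  · simp only [empiricalEntropy, List.ofFn_zero, followers_nil, Finset.sum_const,
      Finset.card_univ, Fintype.card_unique, one_smul]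
    rw [← mul_assoc, one_div, inv_mul_cancel₀ (by simp; positivity), one_mul]

/-- What a one-pass decoder does in one step, as decided by its memory contents:
* `halt`: stop;
* `write a m`: append at most one character `a` to the output (`none` for an internal step) and
  change the memory contents to `m`;
* `read m`: read the next bit of the encoding, and change the memory contents to `m (some b)` if
  that bit is `b`, and to `m none` if there is no bit left. -/
inductive Move : Type
  | halt : Move
  | write (a : Option ℕ) (m : List Bool) : Move
  | read (m : Option Bool → List Bool) : Move

/-- A move as a finite piece of data, used to say that moves are computed by an algorithm. -/
def Move.toData :
    Move → Unit ⊕ ((Option ℕ × List Bool) ⊕ (List Bool × (List Bool × List Bool)))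
  | .halt => Sum.inl ()
  | .write a m => Sum.inr (Sum.inl (a, m))
  | .read m => Sum.inr (Sum.inr (m (some false), (m (some true), m none)))

/-- A one-pass decoding algorithm.  It is given the alphabet size `σ`; its memory contents are a
bit string; the initial memory contents, and the move to make with given memory contents, are
computable functions.  Characters of the alphabet of size `σ` are written as `0, …, σ - 1`. -/
structure OnePassDecoder where
  start : ℕ → List Bool
  move : ℕ → List Bool → Move
  computable_start : Computable start
  computable_move : Computable fun p : ℕ × List Bool => (move p.1 p.2).toData

/-- `A.Run σ B m x y`: with alphabet size `σ`, memory contents `m` and unread input `x`,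
the decoder `A` eventually halts, its output from now on is `y`, and its memory contents consist
of at most `B` bits at all times. -/
inductive OnePassDecoder.Run (A : OnePassDecoder) (σ : ℕ) (B : ℝ) :
    List Bool → List Bool → List ℕ → Prop
  | halt {m x : List Bool} (hB : (m.length : ℝ) ≤ B) (hm : A.move σ m = Move.halt) :
      Run A σ B m x []
  | write {m m' x : List Bool} {a : Option ℕ} {y : List ℕ} (hB : (m.length : ℝ) ≤ B)
      (hm : A.move σ m = Move.write a m') (h : Run A σ B m' x y) :
      Run A σ B m x (a.toList ++ y)
  | read {m x : List Bool} {m' : Option Bool → List Bool} {y : List ℕ} (hB : (m.length : ℝ) ≤ B)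
      (hm : A.move σ m = Move.read m') (h : Run A σ B (m' x.head?) x.tail y) :
      Run A σ B m x y

/-- Given the alphabet size `σ` and the encoding `e`, the decoder `A` recovers the string `s` in
one pass over `e`, using at most `B` bits of memory. -/
def OnePassDecoder.Recovers (A : OnePassDecoder) (σ : ℕ) (B : ℝ) (e : List Bool)
    (s : List (Fin σ)) : Prop :=
  A.Run σ B (A.start σ) e (s.map Fin.val)

end

/-! The string repeats a block `r` of length `p = D * q ^ k`, where `D = ⌈σ ^ c⌉`, `c = 1/λ - ε/2`
and `q = ⌊σ / (2(k+1))⌋`. This period exceeds the memory, so the decoder cannot store `r` and must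
get most of it from the encoding again for every copy. The entropy of order `k` does not see the
repetition: it only sees that each context has few followers.

Small entropy: `r` is chosen so that every `k`-word occurs at most `D + 1` times in it. A `k`-word
then has at most `D + 1 + k` distinct followers in `rrr…` (`card_followers_periodicString_le`), so
`λ H_k n ≤ λ n log (D + 1 + k) ≤ (1 - ε/4) n log σ` for large `σ`.

Costly copies: there are at least `(σ/2) ^ p` such blocks (`exists_many_balanced`). The memory
contents at the start of a copy and the bits read during it determine `r`, so some `r` costs each of
`σ` given decoders more than `p (log σ - 4)` bits per copy (`exists_not_emits`). Summing over the
copies (`OnePassDecoder.Run.mul_le_length`) gives `(n - p)(log σ - 4)` bits, which is too many.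

The strings must not depend on the decoder. Decoders are countable, and the string for alphabet size
`σ` defeats those of index below `σ`. -/

/-! ### Blocks in which all short words are rare -/

/-- The number of (possibly overlapping) occurrences of the word `w` in `l`. -/
def occurrences {α : Type} [DecidableEq α] (w : List α) : List α → ℕ
  | [] => if w = [] then 1 else 0
  | a :: l => occurrences w l + if w <+: a :: l then 1 else 0

section Occurrences

variable {α : Type} [DecidableEq α]

theorem occurrences_nil_left (l : List α) : occurrences [] l = l.length + 1 := by
  induction l with
  | nil => simp [occurrences]
  | cons a l ih => simp [occurrences, ih]

theorem occurrences_eq_zero {l w : List α} (h : l.length < w.length) : occurrences w l = 0 := by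
  induction l with
  | nil => simpa [occurrences] using List.length_pos_iff.1 h
  | cons b l ih =>
    rw [List.length_cons] at h
    simp only [occurrences, ih (by omega), zero_add, ite_eq_right_iff, one_ne_zero, imp_false]
    intro hp
    have := hp.length_le
    rw [List.length_cons] at this
    omega

theorem occurrences_le_one {l w : List α} (h : l.length ≤ w.length) : occurrences w l ≤ 1 := by
  cases l with
  | nil => simp only [occurrences]; split_ifs <;> omega
  | cons b l =>
    simp only [occurrences, occurrences_eq_zero (show l.length < w.length from h)]
    split_ifs <;> omega

/-- Every occurrence of `w`, except one at the very start of `l`, is preceded by exactly one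
character. -/
theorem sum_occurrences_cons_add_le [Fintype α] (w l : List α) :
    ∑ a, occurrences (a :: w) l + (if w <+: l then 1 else 0) ≤ occurrences w l := by
  induction l with
  | nil => simp [occurrences]
  | cons b l ih =>
    have h : ∑ a, (if a :: w <+: b :: l then 1 else 0) = if w <+: l then 1 else 0 := by
      simp only [List.cons_prefix_cons]
      by_cases hw : w <+: l <;> simp [hw]
    simp only [occurrences, Finset.sum_add_distrib, h]
    omega

theorem card_frequent_extensions_le [Fintype α] (w l : List α) {M q : ℕ} (hM : 0 < M)
    (h : occurrences w l ≤ M * q) :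
    (Finset.univ.filter fun a => M ≤ occurrences (a :: w) l).card ≤ q := by
  refine Nat.le_of_mul_le_mul_left ?_ hM
  refine le_trans ?_ h
  calc M * (Finset.univ.filter fun a => M ≤ occurrences (a :: w) l).card
      = ∑ a ∈ Finset.univ.filter fun a => M ≤ occurrences (a :: w) l, M := by
        rw [Finset.sum_const, smul_eq_mul, mul_comm]
    _ ≤ ∑ a ∈ Finset.univ.filter fun a => M ≤ occurrences (a :: w) l,
          occurrences (a :: w) l :=
        Finset.sum_le_sum fun a ha => (Finset.mem_filter.1 ha).2
    _ ≤ ∑ a, occurrences (a :: w) l :=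
        Finset.sum_le_sum_of_subset (Finset.filter_subset _ _)
    _ ≤ occurrences w l := le_trans (Nat.le_add_right _ _) (sum_occurrences_cons_add_le w l)

/-- Every word of length `j + 1 ≤ k` occurs at most `D * q ^ (k - (j + 1))` times in `l`. -/
def OccurrencesBounded (D q k : ℕ) (l : List α) : Prop :=
  ∀ j < k, ∀ w : List α, w.length = j + 1 → occurrences w l ≤ D * q ^ (k - (j + 1))

/-- Prepending `a` creates one new occurrence per length, that of `a :: l.take j`. As `l.take j` is
itself rare, at most `q` characters `a` have that word already at its cap; excluding them for all `j
< k` costs at most `k * q` characters. -/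
theorem card_balanced_extensions [Fintype α] {D q k : ℕ} (hD : 0 < D) (hq : 0 < q) {l : List α}
    (hl : OccurrencesBounded D q k l) (hlen : l.length + 1 ≤ D * q ^ k) :
    ∃ E : Finset α, Fintype.card α - k * q ≤ E.card ∧ ∀ a ∈ E, OccurrencesBounded D q k (a :: l) := by
  classical
  let F : ℕ → Finset α := fun j =>
    Finset.univ.filter fun a => D * q ^ (k - (j + 1)) ≤ occurrences (a :: l.take j) l
  have hF : ∀ j ∈ Finset.range k, (F j).card ≤ q := by
    intro j hj
    have hj := Finset.mem_range.1 hj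
    refine card_frequent_extensions_le _ _ (by positivity) ?_
    have e : D * q ^ (k - (j + 1)) * q = D * q ^ (k - j) := by
      rw [mul_assoc, ← pow_succ]
      congr 2
      omega
    rw [e]
    rcases j with _ | j
    · simpa [occurrences_nil_left] using hlen
    · by_cases hjl : j + 1 ≤ l.length
      · exact hl j (by omega) _ (by simp [hjl])
      · rw [List.take_of_length_le (by omega)]
        refine (occurrences_le_one le_rfl).trans ?_
        exact Nat.one_le_iff_ne_zero.2 (by positivity)
  refine ⟨((Finset.range k).biUnion F)ᶜ, ?_, ?_⟩
  · rw [Finset.card_compl]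
    have := Finset.card_biUnion_le_card_mul (Finset.range k) F q hF
    rw [Finset.card_range] at this
    omega
  · intro a ha j hj w hw
    simp only [Finset.mem_compl, Finset.mem_biUnion, Finset.mem_range, not_exists, not_and] at ha
    have ha := ha j hj
    simp only [F, Finset.mem_filter, Finset.mem_univ, true_and, not_le] at ha
    simp only [occurrences]
    split_ifs with hp
    · have e : w = a :: l.take j := by
        have := List.prefix_iff_eq_take.1 hp
        rw [hw, List.take_succ_cons] at this
        exact this
      rw [e]
      exact ha
    · exact hl j hj w hw

theorem exists_many_balanced [Fintype α] {D q k : ℕ} (hD : 0 < D) (hq : 0 < q) (m : ℕ)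
    (hm : m ≤ D * q ^ k) :
    ∃ G : Finset (List α), (Fintype.card α - k * q) ^ m ≤ G.card ∧
      ∀ l ∈ G, l.length = m ∧ OccurrencesBounded D q k l := by
  classical
  induction m with
  | zero =>
    refine ⟨{[]}, by simp, ?_⟩
    intro l hl
    rw [Finset.mem_singleton] at hl
    subst hl
    refine ⟨rfl, fun j _ w hw => ?_⟩
    have : w ≠ [] := by rintro rfl; simp at hw
    simp [occurrences, this]
  | succ m ih =>
    obtain ⟨G, hG, hGb⟩ := ih (by omega)
    have : ∀ l : List α, ∃ E : Finset α, l ∈ G → Fintype.card α - k * q ≤ E.card ∧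
        ∀ a ∈ E, OccurrencesBounded D q k (a :: l) := by
      intro l
      by_cases hl : l ∈ G
      · obtain ⟨E, hE⟩ := card_balanced_extensions hD hq (hGb l hl).2
          (by rw [(hGb l hl).1]; exact hm)
        exact ⟨E, fun _ => hE⟩
      · exact ⟨∅, fun h => absurd h hl⟩
    choose E hE using this
    refine ⟨(G.sigma E).image fun x => x.2 :: x.1, ?_, ?_⟩
    · rw [Finset.card_image_of_injective, Finset.card_sigma, pow_succ]
      · calc (Fintype.card α - k * q) ^ m * (Fintype.card α - k * q)
            ≤ G.card * (Fintype.card α - k * q) := Nat.mul_le_mul_right _ hG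
          _ = ∑ l ∈ G, (Fintype.card α - k * q) := by rw [Finset.sum_const, smul_eq_mul]
          _ ≤ _ := Finset.sum_le_sum fun l hl => (hE l hl).1
      · rintro ⟨l, a⟩ ⟨l', a'⟩ h
        simp only [List.cons.injEq] at h
        obtain ⟨rfl, rfl⟩ := h
        rfl
    · intro l hl
      simp only [Finset.mem_image, Finset.mem_sigma] at hl
      obtain ⟨⟨l, a⟩, ⟨h1, h2⟩, rfl⟩ := hl
      exact ⟨by simp [(hGb l h1).1], (hE l h1).2 a h2⟩

/-- The `+ 1` is needed only for `k = 0`, where the empty word also occurs at the end of `l`. -/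
theorem OccurrencesBounded.occurrences_le {D q k : ℕ} {l w : List α} (hl : OccurrencesBounded D q k l)
    (hlen : l.length = D * q ^ k) (hw : w.length = k) : occurrences w l ≤ D + 1 := by
  rcases k with _ | k
  · rw [List.length_eq_zero_iff.1 hw, occurrences_nil_left, hlen]
    simp
  · have := hl k (by omega) w hw
    simp at this
    omega

theorem card_filter_prefix_drop (w l : List α) :
    ((Finset.range (l.length + 1)).filter fun i => w <+: l.drop i).card = occurrences w l := by
  induction l with
  | nil => 
    simp only [occurrences, List.length_nil, zero_add, Finset.range_one, List.drop_nil,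
      List.prefix_nil]
    by_cases h : w = [] <;> simp [h]
  | cons a l ih =>
    rw [occurrences, ← ih, Finset.card_filter, Finset.card_filter, List.length_cons,
      Finset.sum_range_succ' _ (l.length + 1)]
    simp

end Occurrences

/-! ### Periodic strings and their entropy -/

/-- The first `n` characters of the periodic string `rrr…`. -/
def periodicString {α : Type} (r : List α) (hr : r ≠ []) (n : ℕ) : List α :=
  List.ofFn fun i : Fin n => r[(i : ℕ) % r.length]'(Nat.mod_lt _ (List.length_pos_iff.2 hr))

theorem length_periodicString {α : Type} (r : List α) (hr : r ≠ []) (n : ℕ) :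
    (periodicString r hr n).length = n := by
  simp [periodicString]

theorem getElem?_periodicString {α : Type} (r : List α) (hr : r ≠ []) {n i : ℕ} (hi : i < n) :
    (periodicString r hr n)[i]? = r[i % r.length]? := by
  have := Nat.mod_lt i (List.length_pos_iff.2 hr)
  simp [periodicString, hi, this]

section Entropy

variable {α : Type} [DecidableEq α]

/-- Gibbs' inequality against the uniform weight `1 / M`, from `log x ≤ x - 1` at `x = |t| /
(occ(a,t) M)`. -/
theorem zerothEntropy_le_logb (t : List α) {M : ℝ} (hM : 1 ≤ M) (h : (t.toFinset.card : ℝ) ≤ M) :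
    zerothEntropy t ≤ Real.logb 2 M := by
  have hM0 : 0 < M := by linarith
  rcases t with _ | ⟨b, t'⟩
  · simpa [zerothEntropy] using Real.logb_nonneg one_lt_two hM
  set t := b :: t' with ht
  have hn : (0 : ℝ) < t.length := by simp [ht]; positivity
  have hs : ∑ a ∈ t.toFinset, (t.count a : ℝ) / t.length = 1 := by
    rw [← Finset.sum_div, ← Nat.cast_sum, List.sum_toFinset_count_eq_length, div_self hn.ne']
  have hl2 : 0 < Real.log 2 := Real.log_pos one_lt_two
  have key : ∀ a ∈ t.toFinset, ((t.count a : ℝ) / t.length) *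
      Real.logb 2 ((t.length : ℝ) / t.count a) ≤ ((t.count a : ℝ) / t.length) * Real.logb 2 M +
        (1 / M - (t.count a : ℝ) / t.length) / Real.log 2 := by
    intro a ha
    have hc : (0 : ℝ) < t.count a := by
      exact_mod_cast List.count_pos_iff.2 (List.mem_toFinset.1 ha)
    have h1 := Real.log_le_sub_one_of_pos (x := (t.length : ℝ) / t.count a / M) (by positivity)
    rw [Real.log_div (by positivity) hM0.ne'] at h1
    have h2 : ((t.count a : ℝ) / t.length) * (Real.log ((t.length : ℝ) / t.count a)) ≤
        ((t.count a : ℝ) / t.length) * Real.log M + (1 / M - (t.count a : ℝ) / t.length) := by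
      have h3 := mul_le_mul_of_nonneg_left h1 (show 0 ≤ (t.count a : ℝ) / t.length by positivity)
      have h4 : ((t.count a : ℝ) / t.length) * ((t.length : ℝ) / t.count a / M - 1) =
        1 / M - (t.count a : ℝ) / t.length := by field_simp
      rw [h4] at h3
      linarith
    simp only [Real.logb]
    rw [← mul_div_assoc, ← mul_div_assoc, ← add_div]
    gcongr
  refine (Finset.sum_le_sum key).trans ?_
  rw [Finset.sum_add_distrib, ← Finset.sum_mul, hs, one_mul, ← Finset.sum_div,
    Finset.sum_sub_distrib, hs, Finset.sum_const, nsmul_eq_mul]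
  have : (t.toFinset.card : ℝ) * (1 / M) - 1 ≤ 0 := by
    rw [mul_one_div, sub_nonpos, div_le_one hM0]
    exact h
  have := div_nonpos_of_nonpos_of_nonneg this hl2.le
  linarith

theorem sum_length_followers_le [Fintype α] (k : ℕ) (s : List α) :
    ∑ w : Fin k → α, (followers (List.ofFn w) s).length ≤ s.length := by
  induction s with
  | nil =>
    refine le_of_eq (Finset.sum_eq_zero fun w _ => ?_)
    simp [followers]
  | cons a s ih =>
    -- Only the word formed by the first `k` characters can gain a follower. The default `a` of
    -- `getD` is immaterial, since a follower exists only if there are more than `k` characters.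
    have h : ∀ w : Fin k → α, (followers (List.ofFn w) (a :: s)).length ≤
        (followers (List.ofFn w) s).length +
          if w = (fun i : Fin k => ((a :: s).getD i a)) then 1 else 0 := by
      intro w
      simp only [followers, List.tails_cons, List.filterMap_cons, List.length_ofFn]
      split
      · omega
      · rename_i b hb
        rw [List.length_cons]
        have : w = (fun i : Fin k => ((a :: s).getD i a)) := by
          split_ifs at hb with h1
          obtain ⟨hlt, -⟩ := List.getElem?_eq_some_iff.1 hb
          funext i
          have h2 : (List.ofFn w)[(i : ℕ)]? = some (w i) := by simp
          rw [← h1, List.getElem?_take_of_lt i.2] at h2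
          simp [List.getD_eq_getElem?_getD, h2]
        rw [if_pos this]
    refine (Finset.sum_le_sum fun w _ => h w).trans ?_
    rw [Finset.sum_add_distrib, List.length_cons]
    simpa using ih

theorem empiricalEntropy_mul_length_le [Fintype α] (k : ℕ) (s : List α) {M : ℝ} (hM : 1 ≤ M)
    (h : ∀ w : List α, w.length = k → ((followers w s).toFinset.card : ℝ) ≤ M) :
    empiricalEntropy k s * s.length ≤ s.length * Real.logb 2 M := by
  have h0 := Real.logb_nonneg one_lt_two hM
  have h1 : ∑ w : Fin k → α, ((followers (List.ofFn w) s).length : ℝ) *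
      zerothEntropy (followers (List.ofFn w) s) ≤ s.length * Real.logb 2 M := by
    calc _ ≤ ∑ w : Fin k → α, ((followers (List.ofFn w) s).length : ℝ) * Real.logb 2 M := by
          refine Finset.sum_le_sum fun w _ => mul_le_mul_of_nonneg_left ?_ (Nat.cast_nonneg _)
          exact zerothEntropy_le_logb _ hM (h _ (by simp))
      _ ≤ _ := by
          rw [← Finset.sum_mul]
          refine mul_le_mul_of_nonneg_right ?_ h0
          exact_mod_cast sum_length_followers_le k s
  rcases s with _ | ⟨a, s⟩
  · simp
  · unfold empiricalEntropy
    rw [mul_comm, ← mul_assoc, mul_one_div_cancel (by simp; positivity), one_mul]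
    exact h1

/-- A follower depends only on the starting position modulo the period. Either `w` occurs in `r` at
that residue, or the residue is one of the last `w.length`, where `w` or its follower wraps around.
-/
theorem card_followers_periodicString_le (r : List α) (hr : r ≠ []) (n : ℕ) (w : List α) :
    (followers w (periodicString r hr n)).toFinset.card ≤ occurrences w r + w.length := by
  set p := r.length with hp
  have hp0 : 0 < p := List.length_pos_iff.2 hr
  let I : Finset ℕ := ((Finset.range (p + 1)).filter fun i => w <+: r.drop i) ∪
    (Finset.Ico (p - w.length) p)
  have hI : I.card ≤ occurrences w r + w.length := by
    refine (Finset.card_union_le _ _).trans ?_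
    rw [card_filter_prefix_drop, Nat.card_Ico]
    omega
  refine le_trans ?_ hI
  refine le_trans (Finset.card_le_card (t := I.image fun i =>
    r[(i + w.length) % p]'(Nat.mod_lt _ hp0)) ?_) Finset.card_image_le
  intro a ha
  rw [List.mem_toFinset, followers, List.mem_filterMap] at ha
  obtain ⟨t, ht, hta⟩ := ha
  split_ifs at hta with hw
  rw [List.mem_tails] at ht
  obtain ⟨i, rfl⟩ : ∃ i, t = (periodicString r hr n).drop i :=
    ⟨_, List.suffix_iff_eq_drop.1 ht⟩
  rw [List.getElem?_drop] at hta
  have hin : i + w.length < n := by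
    have := (List.getElem?_eq_some_iff.1 hta).1
    rwa [length_periodicString] at this
  rw [getElem?_periodicString r hr hin] at hta
  rw [Finset.mem_image]
  refine ⟨i % p, ?_, ?_⟩
  · have hip := Nat.mod_lt i hp0
    simp only [I, Finset.mem_union, Finset.mem_filter, Finset.mem_range, Finset.mem_Ico]
    by_cases hc : p - w.length ≤ i % p
    · exact Or.inr ⟨hc, hip⟩
    · refine Or.inl ⟨by omega, ?_⟩
      rw [List.prefix_iff_getElem?]
      intro j hj
      have h1 : w[j]? = some w[j] := List.getElem?_eq_getElem hj
      rw [← h1, ← congrArg (fun v : List α => v[j]?) hw,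
        List.getElem?_take_of_lt hj, List.getElem?_drop, List.getElem?_drop,
        getElem?_periodicString r hr (by omega)]
      congr 1
      rw [← hp, ← Nat.mod_add_mod, Nat.mod_eq_of_lt (by omega : i % p + j < p)]
  · have h1 := (List.getElem?_eq_some_iff.1 hta).2
    simp only [Nat.mod_add_mod]
    exact h1

end Entropy

theorem periodicString_length_add {α : Type} (r : List α) (hr : r ≠ []) (n : ℕ) :
    periodicString r hr (r.length + n) = r ++ periodicString r hr n := by
  refine List.ext_getElem? fun i => ?_
  by_cases hi : i < r.length + n
  · rw [getElem?_periodicString r hr hi]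
    by_cases h : i < r.length
    · rw [List.getElem?_append_left h, Nat.mod_eq_of_lt h]
    · rw [List.getElem?_append_right (by omega), getElem?_periodicString r hr (by omega),
        Nat.mod_eq_sub_mod (by omega)]
  · rw [List.getElem?_eq_none (by rw [length_periodicString]; omega),
      List.getElem?_eq_none (by rw [List.length_append, length_periodicString]; omega)]

theorem periodicString_mul_add {α : Type} (r : List α) (hr : r ≠ []) (N t : ℕ) :
    periodicString r hr (N * r.length + t) =
      (List.replicate N r).flatten ++ periodicString r hr t := by
  induction N with
  | zero => simp
  | succ N ih =>
    rw [List.replicate_succ, List.flatten_cons, List.append_assoc, ← ih,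
      ← periodicString_length_add]
    congr 1
    ring

/-! ### Countability of the decoders -/

theorem Move.toData_injective : Function.Injective Move.toData := by
  intro x y h
  cases x <;> cases y <;> simp only [Move.toData, Sum.inr.injEq, Sum.inl.injEq, reduceCtorEq,
    Prod.mk.injEq] at h
  · rfl
  · rw [h.1, h.2]
  · congr 1
    funext b
    rcases b with _ | _ | _
    · exact h.2.2
    · exact h.1
    · exact h.2.1

/-- A code determines the function that it computes, and codes are countable. -/
theorem countable_computable {α β : Type} [Primcodable α] [Primcodable β] :
    Countable {f : α → β // Computable f} := by
  have : ∀ f : {f : α → β // Computable f}, ∃ c : Nat.Partrec.Code,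
      ∀ a, Encodable.encode (f.1 a) ∈ c.eval (Encodable.encode a) := by
    rintro ⟨f, hf⟩
    obtain ⟨c, hc⟩ := Nat.Partrec.Code.exists_code.1 hf
    refine ⟨c, fun a => ?_⟩
    rw [hc]
    simp
  choose c hc using this
  refine Function.Injective.countable (f := c) ?_
  intro f g h
  refine Subtype.ext (funext fun a => ?_)
  have h1 := hc f a
  rw [h] at h1
  exact Encodable.encode_injective (Part.mem_unique h1 (hc g a))

namespace OnePassDecoder

instance : Inhabited OnePassDecoder :=
  ⟨⟨fun _ => [], fun _ _ => .halt, Computable.const _, Computable.const _⟩⟩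

instance : Countable OnePassDecoder := by
  have h1 := countable_computable (α := ℕ) (β := List Bool)
  have h2 := countable_computable (α := ℕ × List Bool)
    (β := Unit ⊕ ((Option ℕ × List Bool) ⊕ (List Bool × (List Bool × List Bool))))
  refine Function.Injective.countable
    (β := {f : ℕ → List Bool // Computable f} × {f : ℕ × List Bool →
      Unit ⊕ ((Option ℕ × List Bool) ⊕ (List Bool × (List Bool × List Bool))) // Computable f})
    (f := fun A => (⟨A.start, A.computable_start⟩, ⟨_, A.computable_move⟩)) ?_
  rintro ⟨s, m, hs, hm⟩ ⟨s', m', hs', hm'⟩ h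
  simp only [Prod.mk.injEq, Subtype.mk.injEq] at h
  obtain ⟨rfl, h⟩ := h
  have : m = m' := by
    funext σ x
    exact Move.toData_injective (congrFun h (σ, x))
  subst this
  rfl

/-! ### Cutting a run into copies of the block -/

/-- `A.Emits σ m x y m' x'`: from memory contents `m` and unread input `x`, the decoder gets to
memory contents `m'` and unread input `x'`, while the output is `y`. -/
inductive Emits (A : OnePassDecoder) (σ : ℕ) :
    List Bool → List Bool → List ℕ → List Bool → List Bool → Prop
  | refl (m x : List Bool) : Emits A σ m x [] m x
  | write {m m₁ x m' x' : List Bool} {a : Option ℕ} {y : List ℕ}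
      (hm : A.move σ m = Move.write a m₁) (h : Emits A σ m₁ x y m' x') :
      Emits A σ m x (a.toList ++ y) m' x'
  | read {m x m' x' : List Bool} {m₁ : Option Bool → List Bool} {y : List ℕ}
      (hm : A.move σ m = Move.read m₁) (h : Emits A σ (m₁ x.head?) x.tail y m' x') :
      Emits A σ m x y m' x'

variable {A : OnePassDecoder} {σ : ℕ}

/-- The output depends only on the part of the input that has been read. -/
theorem Emits.exists_read {m x m' x' : List Bool} {y : List ℕ} (h : A.Emits σ m x y m' x') :
    ∃ u, x = u ++ x' ∧ A.Emits σ m u y m' [] := by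
  induction h with
  | refl m x => exact ⟨[], rfl, .refl _ _⟩
  | write hm _ ih =>
    obtain ⟨u, hu, h⟩ := ih
    exact ⟨u, hu, .write hm h⟩
  | @read m x m' x' m₁ y hm h ih =>
    obtain ⟨u, hu, h⟩ := ih
    rcases x with _ | ⟨b, x⟩
    · simp only [List.tail_nil, List.nil_eq, List.append_eq_nil_iff] at hu
      obtain ⟨rfl, rfl⟩ := hu
      exact ⟨[], rfl, .read hm h⟩
    · rw [List.tail_cons] at hu
      exact ⟨b :: u, by rw [hu]; rfl, .read hm h⟩

/-- The decoder is deterministic, so one output is a prefix of the other. The two segments may stop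
at different configurations, and only the lengths of the outputs need to agree. -/
theorem Emits.output_unique {m x m₁ x₁ m₂ x₂ : List Bool} {y z : List ℕ}
    (h₁ : A.Emits σ m x y m₁ x₁) (h₂ : A.Emits σ m x z m₂ x₂) (hl : y.length = z.length) :
    y = z := by
  induction h₁ generalizing z with
  | refl m x => exact (List.length_eq_zero_iff.1 hl.symm).symm
  | write hm h ih =>
    cases h₂ with
    | refl => exact List.length_eq_zero_iff.1 hl
    | write hm' h' =>
      rw [hm, Move.write.injEq] at hm'
      obtain ⟨rfl, rfl⟩ := hm'
      rw [ih h' (by simpa using hl)]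
    | read hm' h' => rw [hm] at hm'; cases hm'
  | read hm h ih =>
    cases h₂ with
    | refl => exact List.length_eq_zero_iff.1 hl
    | write hm' h' => rw [hm] at hm'; cases hm'
    | read hm' h' =>
      rw [hm, Move.read.injEq] at hm'
      subst hm'
      exact ih h' hl

theorem Run.length_le {B : ℝ} {m x : List Bool} {y : List ℕ} (h : A.Run σ B m x y) :
    (m.length : ℝ) ≤ B := by
  cases h <;> assumption

theorem Run.split {B : ℝ} {m x : List Bool} {z : List ℕ} (h : A.Run σ B m x z) {y₁ y₂ : List ℕ}
    (hz : z = y₁ ++ y₂) : ∃ m' x', A.Emits σ m x y₁ m' x' ∧ A.Run σ B m' x' y₂ := by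
  induction h generalizing y₁ with
  | halt hB hm =>
    obtain ⟨rfl, rfl⟩ := List.append_eq_nil_iff.1 hz.symm
    exact ⟨_, _, .refl _ _, .halt hB hm⟩
  | @write m m₁ x a y hB hm h ih =>
    rcases a with _ | a
    · obtain ⟨m', x', h1, h2⟩ := ih hz
      exact ⟨m', x', .write (a := none) hm h1, h2⟩
    · rcases y₁ with _ | ⟨b, y₁⟩
      · subst hz
        exact ⟨_, _, .refl _ _, .write hB hm h⟩
      · simp only [Option.toList_some, List.cons_append, List.nil_append, List.cons.injEq] at hz
        obtain ⟨rfl, hz⟩ := hz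
        obtain ⟨m', x', h1, h2⟩ := ih hz
        exact ⟨m', x', .write (a := some a) hm h1, h2⟩
  | read hB hm h ih =>
    obtain ⟨m', x', h1, h2⟩ := ih hz
    exact ⟨m', x', .read hm h1, h2⟩

/-- If emitting `y` always takes `T` bits of the encoding, then emitting `N` copies of `y` takes
`N * T` bits. -/
theorem Run.mul_le_length {B T : ℝ} {y : List ℕ}
    (hy : ∀ m u m' : List Bool, (m.length : ℝ) ≤ B → A.Emits σ m u y m' [] → T ≤ u.length)
    (N : ℕ) {m x : List Bool} {z : List ℕ}
    (h : A.Run σ B m x ((List.replicate N y).flatten ++ z)) : N * T ≤ x.length := by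
  induction N generalizing m x with
  | zero => simp
  | succ N ih =>
    rw [List.replicate_succ, List.flatten_cons, List.append_assoc] at h
    obtain ⟨m', x', h1, h2⟩ := h.split rfl
    obtain ⟨u, rfl, h3⟩ := h1.exists_read
    have h4 := hy m u m' h.length_le h3
    have h5 := ih h2
    push_cast [List.length_append]
    linarith

end OnePassDecoder

/-! ### Counting: a block that is costly for many decoders -/

theorem exists_finset_list_length_le (L : ℕ) :
    ∃ F : Finset (List Bool), F.card + 1 ≤ 2 ^ (L + 1) ∧ ∀ l, l.length ≤ L → l ∈ F := by
  classical
  induction L with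
  | zero => exact ⟨{[]}, by simp, by simp⟩
  | succ L ih =>
    obtain ⟨F, hF, hl⟩ := ih
    refine ⟨insert [] (F.image (List.cons true) ∪ F.image (List.cons false)), ?_, ?_⟩
    · have h1 := Finset.card_insert_le []
        (F.image (List.cons true) ∪ F.image (List.cons false))
      have h2 := Finset.card_union_le (F.image (List.cons true)) (F.image (List.cons false))
      have h3 := Finset.card_image_le (s := F) (f := List.cons true)
      have h4 := Finset.card_image_le (s := F) (f := List.cons false)
      rw [pow_succ]
      omega
    · rintro (_ | ⟨_ | _, l⟩) h
      · simp
      · simp [hl l (by simpa using h)]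
      · simp [hl l (by simpa using h)]

/-- A large set of strings of the same length contains one that none of the first `c` decoders
emits from few bits of memory and few bits of the encoding. -/
theorem exists_not_emits {σ c p M L : ℕ} (idx : OnePassDecoder → ℕ)
    (hidx : Function.Injective idx) (G : Finset (List (Fin σ))) (hG : ∀ r ∈ G, r.length = p)
    (hcard : c * (2 ^ (M + 1) * 2 ^ (L + 1)) < G.card) :
    ∃ r ∈ G, ∀ A : OnePassDecoder, idx A < c → ∀ m u m' : List Bool, m.length ≤ M →
      A.Emits σ m u (r.map Fin.val) m' [] → L < u.length := by
  by_contra! hcon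
  obtain ⟨F₁, hF₁, hm₁⟩ := exists_finset_list_length_le M
  obtain ⟨F₂, hF₂, hm₂⟩ := exists_finset_list_length_le L
  choose! A hA m u m' hm he hu using hcon
  have h1 : G.card ≤ (Finset.range c ×ˢ (F₁ ×ˢ F₂)).card := by
    -- If every block had a cheap description (decoder, memory contents, bits read), these triples
    -- would be distinct by determinism, and there are too few of them.
    refine Finset.card_le_card_of_injOn (fun r => (idx (A r), m r, u r)) ?_ ?_
    · intro r hr
      simp only [Finset.coe_product, Set.mem_prod, Finset.mem_coe, Finset.mem_range]
      exact ⟨hA r hr, hm₁ _ (hm r hr), hm₂ _ (hu r hr)⟩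
    · intro r hr r' hr' h
      simp only [Prod.mk.injEq] at h
      obtain ⟨h1, h2, h3⟩ := h
      have e1 := he r hr
      rw [hidx h1, h2, h3] at e1
      have e2 := e1.output_unique (he r' hr') (by simp [hG r hr, hG r' hr'])
      exact List.map_injective_iff.2 Fin.val_injective e2
  rw [Finset.card_product, Finset.card_product, Finset.card_range] at h1
  have h2 : F₁.card * F₂.card ≤ 2 ^ (M + 1) * 2 ^ (L + 1) :=
    Nat.mul_le_mul (by omega) (by omega)
  have h3 := Nat.mul_le_mul_left c h2
  omega

theorem exists_incompressible_string (idx : OnePassDecoder → ℕ) (hidx : Function.Injective idx)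
    {σ k D p : ℕ} (hD : 0 < D) (hσ : 2 * (k + 1) ≤ σ) (hlog : 4 ≤ Real.logb 2 σ)
    (hp : p = D * (σ / (2 * (k + 1))) ^ k) (hpσ : 4 * σ < 4 ^ p) :
    ∃ s : ℕ → List (Fin σ), (∀ n, (s n).length = n) ∧
      (∀ n, empiricalEntropy k (s n) * n ≤ n * Real.logb 2 ((D : ℝ) + 1 + k)) ∧
      ∀ A : OnePassDecoder, idx A < σ → ∀ B : ℝ, B ≤ p → ∀ (n : ℕ) (e : List Bool),
        A.Recovers σ B e (s n) → ((n : ℝ) - p) * (Real.logb 2 σ - 4) ≤ e.length := by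
  set q := σ / (2 * (k + 1)) with hq
  have hq0 : 0 < q := Nat.div_pos hσ (by positivity)
  have hp0 : 0 < p := by rw [hp]; positivity
  have hσ0 : (0 : ℝ) < σ := by exact_mod_cast (by omega : 0 < σ)
  have hkq : 2 * (k * q) ≤ σ := by
    have := Nat.div_mul_le_self σ (2 * (k + 1))
    rw [← hq] at this
    nlinarith
  obtain ⟨G, hGc, hG⟩ := exists_many_balanced (α := Fin σ) hD hq0 p hp.le
  rw [Fintype.card_fin] at hGc
  set T : ℝ := p * (Real.logb 2 σ - 4) with hT
  have hT0 : 0 ≤ T := mul_nonneg (Nat.cast_nonneg _) (by linarith)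
  -- The 4 in `log σ - 4` gains a factor `16 ^ p`: `2 ^ p` pays for the memory contents, `2 ^ p` for
  -- having only `(σ/2) ^ p` blocks, and `4 ^ p` for `4 * σ`, that is, the `σ` decoders and the two
  -- exponents `+ 1`.
  have hcard : σ * (2 ^ (p + 1) * 2 ^ (⌊T⌋₊ + 1)) < G.card := by
    have h1 : (2 : ℝ) ^ ⌊T⌋₊ ≤ ((σ : ℝ) / 16) ^ p := by
      rw [← Real.rpow_natCast 2]
      refine (Real.rpow_le_rpow_of_exponent_le one_le_two (Nat.floor_le hT0)).trans ?_
      rw [hT, mul_comm, Real.rpow_mul zero_le_two, Real.rpow_sub two_pos,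
        Real.rpow_logb two_pos (by norm_num) hσ0, Real.rpow_natCast]
      norm_num
    have h2 : ((σ : ℝ) / 2) ^ p ≤ G.card := by
      refine le_trans ?_ (Nat.cast_le.2 hGc)
      rw [Nat.cast_pow]
      refine pow_le_pow_left₀ (by positivity) ?_ _
      rw [Nat.cast_sub (by omega)]
      have : (2 : ℝ) * (k * q : ℕ) ≤ σ := by exact_mod_cast hkq
      linarith
    have h3 : (4 : ℝ) * σ < 4 ^ p := by exact_mod_cast hpσ
    have h4 : (σ : ℝ) * (2 ^ (p + 1) * 2 ^ (⌊T⌋₊ + 1)) < G.card := by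
      calc (σ : ℝ) * (2 ^ (p + 1) * 2 ^ (⌊T⌋₊ + 1)) = 4 * σ * (2 ^ p * 2 ^ ⌊T⌋₊) := by ring
        _ ≤ 4 * σ * (2 ^ p * ((σ : ℝ) / 16) ^ p) := by gcongr
        _ = 4 * σ * ((σ : ℝ) / 8) ^ p := by rw [← mul_pow]; ring_nf
        _ < 4 ^ p * ((σ : ℝ) / 8) ^ p := by gcongr
        _ = ((σ : ℝ) / 2) ^ p := by rw [← mul_pow]; ring_nf
        _ ≤ G.card := h2
    exact_mod_cast h4
  obtain ⟨r, hrG, hr⟩ := exists_not_emits idx hidx G (fun r hr => (hG r hr).1) hcard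
  obtain ⟨hrp, hrb⟩ := hG r hrG
  have hr0 : r ≠ [] := List.length_pos_iff.1 (hrp ▸ hp0)
  refine ⟨periodicString r hr0, length_periodicString r hr0, ?_, ?_⟩
  · intro n
    have hk : (0 : ℝ) ≤ k := Nat.cast_nonneg _
    have hDr : (0 : ℝ) ≤ D := Nat.cast_nonneg _
    have := empiricalEntropy_mul_length_le k (periodicString r hr0 n)
      (M := (D : ℝ) + 1 + k) (by linarith) ?_
    · rwa [length_periodicString] at this
    · intro w hw
      have h1 := card_followers_periodicString_le r hr0 n w
      have h2 := hrb.occurrences_le (hrp.trans hp) hw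
      have h3 : (followers w (periodicString r hr0 n)).toFinset.card ≤ D + 1 + k := by omega
      exact_mod_cast h3
  · intro A hA B hB n e he
    have h1 : n = n / p * r.length + n % p := by
      rw [hrp, mul_comm]
      exact (Nat.div_add_mod n p).symm
    unfold OnePassDecoder.Recovers at he
    rw [h1, periodicString_mul_add, List.map_append, List.map_flatten, List.map_replicate] at he
    have h2 := he.mul_le_length (T := T) (fun m u m' hm hu => by
      have h3 := hr A hA m u m' (by exact_mod_cast hm.trans hB) hu
      exact ((Nat.floor_lt hT0).1 h3).le)
    refine le_trans ?_ h2
    rw [hT, ← mul_assoc]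
    refine mul_le_mul_of_nonneg_right ?_ (by linarith)
    have h4 := Nat.mod_lt n hp0
    have h5 := Nat.div_add_mod n p
    have h6 : n ≤ n / p * p + p := by rw [mul_comm]; omega
    have h7 : (n : ℝ) ≤ (n / p : ℕ) * p + p := by exact_mod_cast h6
    linarith

/-! ### Asymptotics in `σ` and the conclusion -/

theorem tendsto_rpow_natCast_atTop {c : ℝ} (hc : 0 < c) :
    Tendsto (fun σ : ℕ => (σ : ℝ) ^ c) atTop atTop :=
  (tendsto_rpow_atTop hc).comp tendsto_natCast_atTop_atTop

theorem tendsto_logb_natCast_atTop :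
    Tendsto (fun σ : ℕ => Real.logb 2 (σ : ℝ)) atTop atTop :=
  (Real.tendsto_logb_atTop one_lt_two).comp tendsto_natCast_atTop_atTop

theorem eventually_four_mul_lt_four_pow {c : ℝ} (hc : 0 < c) :
    ∀ᶠ σ : ℕ in atTop, ∀ p : ℕ, (σ : ℝ) ^ c ≤ p → 4 * σ < 4 ^ p := by
  have h1 : ∀ᶠ x : ℝ in atTop, ‖Real.log x‖ ≤ (1 / 2) * ‖x ^ c‖ :=
    (isLittleO_log_rpow_atTop hc).bound (by norm_num)
  filter_upwards [tendsto_natCast_atTop_atTop.eventually h1,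
    (tendsto_rpow_natCast_atTop hc).eventually_ge_atTop 4, eventually_ge_atTop 1]
    with σ h1 h2 h3 p hp
  have hσ : (0 : ℝ) < σ := by exact_mod_cast h3
  have hl4 : 1 < Real.log 4 := by
    rw [show (4 : ℝ) = 2 ^ 2 by norm_num, Real.log_pow]
    have := Real.log_two_gt_d9
    push_cast
    linarith
  rw [Real.norm_eq_abs, Real.norm_eq_abs, abs_of_nonneg (Real.rpow_nonneg hσ.le _)] at h1
  have h4 := (le_abs_self _).trans h1
  have h5 : (4 : ℝ) * σ < 4 ^ p := by
    rw [← Real.log_lt_log_iff (by positivity) (by positivity), Real.log_mul (by norm_num) hσ.ne',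
      Real.log_pow]
    have h6 : Real.log 4 < 2 := by
      rw [show (4 : ℝ) = 2 ^ 2 by norm_num, Real.log_pow]
      have := Real.log_two_lt_d9
      push_cast
      linarith
    have h7 : (p : ℝ) * 1 ≤ p * Real.log 4 :=
      mul_le_mul_of_nonneg_left hl4.le (Nat.cast_nonneg _)
    linarith
  exact_mod_cast h5

theorem eventually_const_mul_rpow_le {a b : ℝ} (hab : a < b) (K : ℝ) :
    ∀ᶠ σ : ℕ in atTop, K * (σ : ℝ) ^ a ≤ (σ : ℝ) ^ b := by
  filter_upwards [(tendsto_rpow_natCast_atTop (sub_pos.2 hab)).eventually_ge_atTop K,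
    eventually_ge_atTop 1] with σ h1 h2
  have hσ : (0 : ℝ) < σ := by exact_mod_cast h2
  have := mul_le_mul_of_nonneg_right h1 (Real.rpow_nonneg hσ.le a)
  rwa [← Real.rpow_add hσ, sub_add_cancel] at this

theorem rpow_le_mul_div_pow {c : ℝ} {k σ D : ℕ} (hσ : 2 * (k + 1) ≤ σ) (hD : (σ : ℝ) ^ c ≤ D) :
    (σ : ℝ) ^ (k + c) ≤ (4 * ((k : ℝ) + 1)) ^ k * ((D * (σ / (2 * (k + 1))) ^ k : ℕ) : ℝ) := by
  set q := σ / (2 * (k + 1)) with hq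
  have hq0 : 0 < q := Nat.div_pos hσ (by positivity)
  have hσ0 : (0 : ℝ) < σ := by exact_mod_cast (by omega : 0 < σ)
  have h1 : σ ≤ 4 * (k + 1) * q := by
    have h2 := Nat.div_add_mod σ (2 * (k + 1))
    have h3 := Nat.mod_lt σ (show 0 < 2 * (k + 1) by positivity)
    rw [← hq] at h2
    nlinarith
  have h2 : (σ : ℝ) ≤ 4 * ((k : ℝ) + 1) * q := by exact_mod_cast h1
  rw [Real.rpow_add hσ0, Real.rpow_natCast]
  push_cast
  calc (σ : ℝ) ^ k * (σ : ℝ) ^ c ≤ (4 * ((k : ℝ) + 1) * q) ^ k * D := by gcongr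
    _ = _ := by rw [mul_pow]; ring

/-- The condition `ε ≤ 1 / lam` makes `c` positive. Quantifying over `B` lets `C` and `ε` be changed
afterwards without proving `Recovers` monotone in the memory bound. -/
theorem exists_strings_lower_bound {lam ε : ℝ} (hlam : 1 ≤ lam) (k : ℕ) (hε : 0 < ε)
    (hε' : ε ≤ 1 / lam) :
    ∃ s : (σ : ℕ) → (n : ℕ) → List (Fin σ),
      (∀ σ n : ℕ, 0 < σ → (s σ n).length = n) ∧
      ∀ (A : OnePassDecoder) (C : ℝ) (g : ℕ → ℝ) (f : ℕ → ℕ → ℝ),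
        (∀ δ : ℝ, 0 < δ → ∀ᶠ σ : ℕ in atTop, ∀ᶠ n : ℕ in atTop,
          f σ n ≤ δ * ((n : ℝ) * Real.logb 2 (σ : ℝ))) →
        ∀ᶠ σ : ℕ in atTop, ∀ᶠ n : ℕ in atTop, ∀ (B : ℝ) (e : List Bool),
          B ≤ C * (σ : ℝ) ^ ((k : ℝ) + 1 / lam - ε) →
          (e.length : ℝ) ≤ lam * empiricalEntropy k (s σ n) * (n : ℝ) + f σ n + g σ →
          ¬ A.Recovers σ B e (s σ n) := by
  obtain ⟨idx, hidx⟩ := exists_injective_nat OnePassDecoder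
  -- Above `1/λ - ε`, so that the period outgrows the memory; below `1/λ - ε/4`, so that the entropy
  -- still leaves a gap.
  set c : ℝ := 1 / lam - ε / 2 with hc
  have hc0 : 0 < c := by linarith
  have hlam0 : 0 < lam := by linarith
  let D : ℕ → ℕ := fun σ => ⌈(σ : ℝ) ^ c⌉₊
  let P : ℕ → ℕ := fun σ => D σ * (σ / (2 * (k + 1))) ^ k
  have hs : ∀ σ : ℕ, ∃ s : ℕ → List (Fin σ), (0 < σ → ∀ n, (s n).length = n) ∧
      (2 * (k + 1) ≤ σ → 4 ≤ Real.logb 2 σ → 4 * σ < 4 ^ P σ →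
      (∀ n, empiricalEntropy k (s n) * n ≤ n * Real.logb 2 ((D σ : ℝ) + 1 + k)) ∧
      ∀ A : OnePassDecoder, idx A < σ → ∀ B : ℝ, B ≤ P σ → ∀ (n : ℕ) (e : List Bool),
        A.Recovers σ B e (s n) → ((n : ℝ) - P σ) * (Real.logb 2 σ - 4) ≤ e.length) := by
    intro σ
    by_cases h : 2 * (k + 1) ≤ σ ∧ 4 ≤ Real.logb 2 σ ∧ 4 * σ < 4 ^ P σ
    · have hσ : (0 : ℝ) < σ := by exact_mod_cast (by omega : 0 < σ)
      obtain ⟨s, h1, h2⟩ := exists_incompressible_string idx hidx (D := D σ)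
        (Nat.ceil_pos.2 (Real.rpow_pos_of_pos hσ c)) h.1 h.2.1 rfl h.2.2
      exact ⟨s, fun _ => h1, fun _ _ _ => h2⟩
    -- For the remaining small `σ` any string will do.
    · rcases Nat.eq_zero_or_pos σ with h0 | h0
      · exact ⟨fun _ => [], fun h' => by omega, fun h1 h2 h3 => absurd ⟨h1, h2, h3⟩ h⟩
      · exact ⟨fun n => List.replicate n ⟨0, h0⟩, fun _ n => by simp,
          fun h1 h2 h3 => absurd ⟨h1, h2, h3⟩ h⟩
  choose s hlen hs using hs
  refine ⟨s, fun σ n hσ => hlen σ hσ n, ?_⟩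
  intro A C g f hf
  have hD : ∀ σ : ℕ, (σ : ℝ) ^ c ≤ D σ := fun σ => Nat.le_ceil _
  filter_upwards [hf (ε / 16) (by positivity), eventually_ge_atTop (2 * (k + 1)),
    tendsto_logb_natCast_atTop.eventually_ge_atTop 4,
    tendsto_logb_natCast_atTop.eventually_ge_atTop (80 / ε),
    eventually_four_mul_lt_four_pow hc0,
    eventually_gt_atTop (idx A),
    eventually_const_mul_rpow_le (show c < 1 / lam - ε / 4 by linarith) ((k : ℝ) + 3),
    eventually_const_mul_rpow_le (show (k : ℝ) + 1 / lam - ε < k + c by linarith)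
      (C * (4 * ((k : ℝ) + 1)) ^ k)]
    with σ hfσ hσk hlog hlogε hpow hA hDk hCk
  have hσ : (0 : ℝ) < σ := by exact_mod_cast (by omega : 0 < σ)
  have hσ1 : (1 : ℝ) ≤ σ := by exact_mod_cast (by omega : 1 ≤ σ)
  set ℓ := Real.logb 2 (σ : ℝ) with hℓ
  have hPD : D σ ≤ P σ :=
    Nat.le_mul_of_pos_right _ (pow_pos (Nat.div_pos hσk (by positivity)) _)
  obtain ⟨hent, hdec⟩ := hs σ hσk hlog
    (hpow _ ((hD σ).trans (Nat.cast_le.2 hPD)))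
  have hB : C * (σ : ℝ) ^ ((k : ℝ) + 1 / lam - ε) ≤ P σ := by
    have h1 := hCk.trans (rpow_le_mul_div_pow hσk (hD σ))
    have h2 : (0 : ℝ) < (4 * ((k : ℝ) + 1)) ^ k := by positivity
    rw [mul_right_comm, mul_comm] at h1
    exact le_of_mul_le_mul_left h1 h2
  have hDlog : Real.logb 2 ((D σ : ℝ) + 1 + k) ≤ (1 / lam - ε / 4) * ℓ := by
    rw [hℓ, ← Real.logb_rpow_eq_mul_logb_of_pos hσ]
    refine Real.logb_le_logb_of_le one_lt_two (by positivity) ?_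
    refine le_trans ?_ hDk
    have h1 : (D σ : ℝ) < (σ : ℝ) ^ c + 1 := Nat.ceil_lt_add_one (Real.rpow_nonneg hσ.le _)
    have h2 : 1 ≤ (σ : ℝ) ^ c := Real.one_le_rpow hσ1 hc0.le
    have h3 : (k : ℝ) * 1 ≤ k * (σ : ℝ) ^ c := mul_le_mul_of_nonneg_left h2 (Nat.cast_nonneg _)
    linarith
  filter_upwards [hfσ,
    tendsto_natCast_atTop_atTop.eventually_gt_atTop ((P σ : ℝ) * (ℓ - 4) + g σ)]
    with n hfn hn B e hBe he hrec
  have h1 := hdec A hA B (hBe.trans hB) n e hrec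
  have hn0 : (0 : ℝ) ≤ n := Nat.cast_nonneg _
  have h2 : lam * empiricalEntropy k (s σ n) * n ≤ (1 - ε / 4) * (n * ℓ) := by
    calc lam * empiricalEntropy k (s σ n) * n
        = lam * (empiricalEntropy k (s σ n) * n) := by ring
      _ ≤ lam * (n * ((1 / lam - ε / 4) * ℓ)) := by
          refine mul_le_mul_of_nonneg_left ?_ hlam0.le
          exact (hent n).trans (mul_le_mul_of_nonneg_left hDlog hn0)
      _ = (1 - lam * (ε / 4)) * (n * ℓ) := by field_simp
      _ ≤ (1 - ε / 4) * (n * ℓ) := by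
          have : 1 * (ε / 4) ≤ lam * (ε / 4) := by gcongr
          have h0 : 0 ≤ (n : ℝ) * ℓ := mul_nonneg hn0 (by linarith)
          gcongr
          linarith
  have h3 : (5 : ℝ) * n ≤ ε / 16 * (n * ℓ) := by
    have : 80 ≤ ℓ * ε := (div_le_iff₀ hε).1 hlogε
    have := mul_le_mul_of_nonneg_right this hn0
    linarith
  have h4 : 0 ≤ ε * (n * ℓ) := by
    have : 0 ≤ ℓ := by linarith
    positivity
  -- The decoder needs `nℓ - 4n - P(ℓ - 4)` bits, and `P(ℓ - 4) + g < n`. The encoding has at most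
  -- `(1 - ε/4 + ε/16) nℓ + g` bits, so `(3ε/16) nℓ < 5n ≤ (ε/16) nℓ`, which is absurd.
  linarith

theorem mainTheorem4 (lam : ℝ) (hlam : 1 ≤ lam) (k : ℕ) (ε : ℝ) (hε : 0 < ε) :
    ∃ s : (σ : ℕ) → (n : ℕ) → List (Fin σ),
      (∀ σ n : ℕ, 0 < σ → (s σ n).length = n) ∧
      ∀ (A : OnePassDecoder) (C : ℝ) (g : ℕ → ℝ) (f : ℕ → ℕ → ℝ),
        (∀ δ : ℝ, 0 < δ → ∀ᶠ σ : ℕ in atTop, ∀ᶠ n : ℕ in atTop,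
          f σ n ≤ δ * ((n : ℝ) * Real.logb 2 (σ : ℝ))) →
        ∀ᶠ σ : ℕ in atTop, ∀ᶠ n : ℕ in atTop, ∀ e : List Bool,
          (e.length : ℝ) ≤ lam * empiricalEntropy k (s σ n) * (n : ℝ) + f σ n + g σ →
          ¬ A.Recovers σ (C * (σ : ℝ) ^ ((k : ℝ) + 1 / lam - ε)) e (s σ n) := by
  -- Decreasing `ε` only enlarges the memory allowed, as does replacing `C` by `|C|`.
  obtain ⟨s, hlen, hs⟩ := exists_strings_lower_bound hlam k (ε := min ε (1 / lam))
    (lt_min hε (by positivity)) (min_le_right _ _)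
  refine ⟨s, hlen, fun A C g f hf => ?_⟩
  filter_upwards [hs A |C| g f hf, eventually_ge_atTop 1] with σ hσ hσ1
  filter_upwards [hσ] with n hn e he
  have h1 : (1 : ℝ) ≤ σ := by exact_mod_cast hσ1
  refine hn _ e ?_ he
  gcongr
  · exact le_abs_self C
  · exact min_le_left _ _
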